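/- Let $\alpha<\beta$ be real numbers, $\Omega=(\alpha,\beta)$ and $1\le p<\infty$. Let $F\in C^1([\alpha,\beta],\mathbb R)$ be decreasing (in the weak sense) with $F(\alpha)=0$ and $F(x)<0$ for all $x\in(\alpha,\beta]$. Assume that for every $x_0\in\Omega$ the solution $t\mapsto\varphi(t,x_0)$ of $\dot x=F(x)$, $x(0)=x_0$, exists in $\Omega$ for all $t\ge 0$, and that for every $x\in\Omega$ there is $\bar t>0$ with $x\notin\varphi(\bar t,\Omega)$. Let $\lambda\in\mathbb R$ and $h=-\lambda F'$ on $\Omega$. Then the formula $$(T_{F,h}(t)f)(x)=\exp\Big(\int_0^t h(\varphi(s,x))\,ds\Big)\,f(\varphi(t,x)),\qquad t\ge 0,\ f\in L^p(\Omega),\ x\in\Omega,$$ defines a $C_0$-semigroup $\mathcal T_{F,h}=(T_{F,h}(t))_{t\ge0}$ of bounded linear operators on the real space $L^p(\Omega)=L^p(\Omega;\mathbb R)$ (with Lebesgue measure), and the following conditions are equivalent: (i) $\mathcal T_{F,h}$ is stable, i.e. $\lim_{t\to+\infty}\|T_{F,h}(t)f\|_p=0$ for every $f\in L^p(\Omega)$;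 (ii) $\mathcal T_{F,h}$ is not hypercyclic, i.e. there is no $f\in L^p(\Omega)$ whose orbit $\{T_{F,h}(t)f : t\ge 0\}$ is dense in $L^p(\Omega)$; (iii) $\lambda\le-\frac1p$. -/

import Mathlib

open Set Filter MeasureTheory Topology
open scoped NNReal ENNReal

/-- A strongly continuous one-parameter semigroup of bounded linear operators. -/
structure IsC0Semigroup {X : Type*} [NormedAddCommGroup X] [NormedSpace ℝ X]
    (T : ℝ≥0 → (X →L[ℝ] X)) : Prop where
  map_zero : T 0 = ContinuousLinearMap.id ℝ X
  map_add : ∀ s t : ℝ≥0, T (s + t) = (T s).comp (T t)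
  continuous_orbit : ∀ x : X, Continuous fun t : ℝ≥0 => T t x

/-- Stability: every orbit tends to `0` in norm. -/
def IsStableSemigroup {X : Type*} [NormedAddCommGroup X] [NormedSpace ℝ X]
    (T : ℝ≥0 → (X →L[ℝ] X)) : Prop :=
  ∀ x : X, Tendsto (fun t : ℝ≥0 => ‖T t x‖) atTop (𝓝 0)

/-- Hypercyclicity: some orbit is dense. -/
def IsHypercyclicSemigroup {X : Type*} [NormedAddCommGroup X] [NormedSpace ℝ X]
    (T : ℝ≥0 → (X →L[ℝ] X)) : Prop :=
  ∃ x : X, Dense (range fun t : ℝ≥0 => T t x)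

/-- `φ` is the semiflow of `x' = F x` on `Ω`: for every `x ∈ Ω`, the solution `φ · x` starting
at `x` is defined for all times `t ≥ 0` and stays in `Ω`. If `F` is locally Lipschitz on `Ω`,
this determines `φ t x` for all `t ≥ 0` and `x ∈ Ω`; other values of `φ` are irrelevant. -/
structure IsSemiflowOf (F : ℝ → ℝ) (Ω : Set ℝ) (φ : ℝ → ℝ → ℝ) : Prop where
  initial : ∀ x ∈ Ω, φ 0 x = x
  mem : ∀ x ∈ Ω, ∀ t : ℝ, 0 ≤ t → φ t x ∈ Ω
  solution : ∀ x ∈ Ω, ∀ t : ℝ, 0 ≤ t →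
    HasDerivWithinAt (fun s => φ s x) (F (φ t x)) (Ici 0) t

/-- The cocycle `h_t(x) = exp (∫₀ᵗ h(φ(s,x)) ds)`. -/
noncomputable def cocycle (h : ℝ → ℝ) (φ : ℝ → ℝ → ℝ) (t x : ℝ) : ℝ :=
  Real.exp (∫ s in (0 : ℝ)..t, h (φ s x))

/-- `T` is the family of weighted composition operators `(T(t) f)(x) = h_t(x) f(φ(t,x))` on
`L^p(Ω)`, with Lebesgue measure on `Ω`. This determines every `T t`. -/
def IsWeightedComposition (Ω : Set ℝ) (φ : ℝ → ℝ → ℝ) (h : ℝ → ℝ) (p : ℝ≥0∞) [Fact (1 ≤ p)]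
    (T : ℝ≥0 → (Lp ℝ p (volume.restrict Ω) →L[ℝ] Lp ℝ p (volume.restrict Ω))) : Prop :=
  ∀ (t : ℝ≥0) (f : Lp ℝ p (volume.restrict Ω)),
    T t f =ᵐ[volume.restrict Ω] fun x => cocycle h φ t x * f (φ t x)

/-! A primitive `G` of `1 / F` turns the flow into translation, `G (φ t x) = G x + t`. Hence `φ t`
is injective with spatial derivative `D t x = F (φ t x) / F x`. Since `F` is negative and decreasing
and orbits move left to the zero `α` of `F`, `D` lies in `(0, 1]` and tends to `0`; since `log D` is
the integral of `F'` along the orbit, the cocycle for `h = -λ F'` is exactly `D ^ (-λ)`.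

Changing variables `y = φ t x`, with Jacobian `D`, leaves the weight `D ^ (-(1 + λ p))` against `|f|
^ p` on the range `φ t '' Ω`, so the sign of `1 + λ p` decides. If `1 + λ p ≤ 0`, the weight is at
most `1` and the norm of `T t f` is bounded by that of `f` on the range, which vanishes because
every point eventually leaves the range (`tendsto_eLpNorm_image`). If `1 + λ p > 0`, altering `y` on
the range alone gives `v` with `T s v = z` (`exists_preimage`). The alteration has norm at most `(∫
D ^ (1 + λ p) |z| ^ p) ^ (1 / p)` plus the norm of `y` on the range, and both terms vanish; a Baire
argument then yields a dense orbit. A stable semigroup has bounded orbits, so the two cases exclude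
each other. -/

/-- A semiflow of injective differentiable self-maps of `Ω` with derivatives `D t x ∈ (0, 1]`
bounded below by `exp (-L t)`, along which every point leaves the range and `D t x → 0`. -/
structure IsContractingFlow (Ω : Set ℝ) (φ D : ℝ → ℝ → ℝ) (L : ℝ) : Prop where
  nonneg : 0 ≤ L
  initial : ∀ x ∈ Ω, φ 0 x = x
  mem : ∀ t, 0 ≤ t → ∀ x ∈ Ω, φ t x ∈ Ω
  add : ∀ s t, 0 ≤ s → 0 ≤ t → ∀ x ∈ Ω, φ (s + t) x = φ s (φ t x)
  injOn : ∀ t, 0 ≤ t → InjOn (φ t) Ω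
  hasDerivAt : ∀ t, 0 ≤ t → ∀ x ∈ Ω, HasDerivAt (φ t) (D t x) x
  continuousOn_time : ∀ x ∈ Ω, ContinuousOn (fun t => φ t x) (Ici 0)
  D_continuousOn_time : ∀ x ∈ Ω, ContinuousOn (fun t => D t x) (Ici 0)
  D_continuousOn : ∀ t, 0 ≤ t → ContinuousOn (D t) Ω
  D_add : ∀ s t, 0 ≤ s → 0 ≤ t → ∀ x ∈ Ω, D (s + t) x = D s (φ t x) * D t x
  D_le_one : ∀ t, 0 ≤ t → ∀ x ∈ Ω, D t x ≤ 1
  le_D : ∀ t, 0 ≤ t → ∀ x ∈ Ω, Real.exp (-(L * t)) ≤ D t x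
  tendsto_D : ∀ x ∈ Ω, Tendsto (fun t => D t x) atTop (𝓝 0)
  eventually_notMem : ∀ y ∈ Ω, ∀ᶠ t in atTop, y ∉ φ t '' Ω

/-! ### Geometry of the flow and its spatial derivative -/

/-- A primitive of `1 / F` straightens the semiflow of `F`. -/
theorem exists_straightening {α β : ℝ} {F : ℝ → ℝ} (hαβ : α < β)
    (hF : ContinuousOn F (Ioo α β)) (hneg : ∀ x ∈ Ioo α β, F x < 0)
    {φ : ℝ → ℝ → ℝ} (hφ : IsSemiflowOf F (Ioo α β) φ) :
    ∃ G : ℝ → ℝ, (∀ x ∈ Ioo α β, HasStrictDerivAt G (F x)⁻¹ x) ∧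
      StrictAntiOn G (Ioo α β) ∧
      ∀ x ∈ Ioo α β, ∀ t, 0 ≤ t → G (φ t x) = G x + t := by
  obtain ⟨m, hm⟩ := exists_between hαβ
  have hinv : ContinuousOn (fun y => (F y)⁻¹) (Ioo α β) :=
    hF.inv₀ fun x hx => (hneg x hx).ne
  have hG : ∀ x ∈ Ioo α β,
      HasStrictDerivAt (fun x => ∫ y in m..x, (F y)⁻¹) (F x)⁻¹ x := fun x hx =>
    intervalIntegral.integral_hasStrictDerivAt_right
      ((hinv.mono (ordConnected_Ioo.uIcc_subset hm hx)).intervalIntegrable)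
      (hinv.stronglyMeasurableAtFilter isOpen_Ioo x hx)
      (hinv.continuousAt (isOpen_Ioo.mem_nhds hx))
  refine ⟨fun x => ∫ y in m..x, (F y)⁻¹, hG, ?_, ?_⟩
  · refine strictAntiOn_of_deriv_neg (convex_Ioo α β)
      (fun x hx => (hG x hx).hasDerivAt.continuousAt.continuousWithinAt) fun x hx => ?_
    rw [interior_Ioo] at hx
    rw [(hG x hx).hasDerivAt.deriv]
    exact inv_lt_zero.2 (hneg x hx)
  · intro x hx t ht
    have hder : ∀ s, 0 ≤ s → HasDerivWithinAt
        (fun s => (∫ y in m..φ s x, (F y)⁻¹) - s) 0 (Ici 0) s := fun s hs => by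
      have h1 := ((hG _ (hφ.mem x hx s hs)).hasDerivAt.comp_hasDerivWithinAt s
        (hφ.solution x hx s hs)).sub (hasDerivWithinAt_id s (Ici 0))
      rwa [inv_mul_cancel₀ (hneg _ (hφ.mem x hx s hs)).ne, sub_self] at h1
    -- By the chain rule `G ∘ φ` grows at unit speed, so subtracting `s` leaves a constant.
    have := constant_of_has_deriv_right_zero (a := 0) (b := t)
      (fun s hs => (hder s hs.1).continuousWithinAt.mono Icc_subset_Ici_self)
      (fun s hs => (hder s hs.1).mono (Ici_subset_Ici.2 hs.1)) t ⟨ht, le_rfl⟩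
    simp only [hφ.initial x hx] at this
    linarith

theorem IsSemiflowOf.continuousOn_time {F : ℝ → ℝ} {Ω : Set ℝ} {φ : ℝ → ℝ → ℝ}
    (hφ : IsSemiflowOf F Ω φ) {x : ℝ} (hx : x ∈ Ω) : ContinuousOn (fun t => φ t x) (Ici 0) :=
  fun t ht => (hφ.solution x hx t ht).continuousWithinAt

/-- The logarithm of the spatial derivative of the flow is the integral of `F'` along orbits. -/
theorem IsSemiflowOf.integral_deriv_comp {Ω : Set ℝ} (hΩ : IsOpen Ω) {F : ℝ → ℝ}
    (hF : ContDiffOn ℝ 1 F Ω) (hneg : ∀ x ∈ Ω, F x < 0)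
    {φ : ℝ → ℝ → ℝ} (hφ : IsSemiflowOf F Ω φ) {x : ℝ} (hx : x ∈ Ω) {t : ℝ} (ht : 0 ≤ t) :
    ∫ s in (0 : ℝ)..t, deriv F (φ s x) = Real.log (F (φ t x) / F x) := by
  have hFd : ∀ y ∈ Ω, HasDerivAt F (deriv F y) y := fun y hy =>
    ((hF.differentiableOn one_ne_zero).differentiableAt (hΩ.mem_nhds hy)).hasDerivAt
  have hder : ∀ s, 0 ≤ s → HasDerivWithinAt (fun s => Real.log (F (φ s x)))
      (deriv F (φ s x)) (Ici 0) s := fun s hs => by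
    have hne := (hneg _ (hφ.mem x hx s hs)).ne
    have h1 := ((hFd _ (hφ.mem x hx s hs)).comp_hasDerivWithinAt s
      (hφ.solution x hx s hs)).log hne
    rwa [Function.comp_apply, mul_div_cancel_right₀ _ hne] at h1
  have hcont : ContinuousOn (fun s => deriv F (φ s x)) (Ici 0) :=
    (hF.continuousOn_deriv_of_isOpen hΩ le_rfl).comp (hφ.continuousOn_time hx)
      fun s hs => hφ.mem x hx s hs
  rw [intervalIntegral.integral_eq_sub_of_hasDeriv_right_of_le ht
    (f := fun s => Real.log (F (φ s x)))
    (fun s hs => (hder s hs.1).continuousWithinAt.mono Icc_subset_Ici_self)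
    (fun s hs => (hder s hs.1.le).mono (Ioi_subset_Ici hs.1.le))
    ((hcont.mono (by rw [uIcc_of_le ht]; exact Icc_subset_Ici_self)).intervalIntegrable),
    hφ.initial x hx, Real.log_div (hneg _ (hφ.mem x hx t ht)).ne (hneg x hx).ne]

/-- The later analysis uses only these properties of `φ` and `D`; `F` plays no further role there.
Uniqueness of solutions is never invoked: the semigroup law follows from injectivity of `G`. -/
theorem isContractingFlow_of_isSemiflowOf {α β : ℝ} (hαβ : α < β) {F : ℝ → ℝ}
    (hF : ContDiffOn ℝ 1 F (Icc α β)) (hFanti : AntitoneOn F (Icc α β))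
    (hFneg : ∀ x ∈ Ioc α β, F x < 0) (hFα : F α = 0)
    {φ : ℝ → ℝ → ℝ} (hφ : IsSemiflowOf F (Ioo α β) φ)
    (hleave : ∀ x ∈ Ioo α β, F x ≠ 0 → ∃ t : ℝ, 0 < t ∧ x ∉ φ t '' Ioo α β) :
    ∃ L, IsContractingFlow (Ioo α β) φ (fun t x => F (φ t x) / F x) L := by
  have hneg : ∀ x ∈ Ioo α β, F x < 0 := fun x hx => hFneg x ⟨hx.1, hx.2.le⟩
  have hFo : ContDiffOn ℝ 1 F (Ioo α β) := hF.mono Ioo_subset_Icc_self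
  obtain ⟨G, hG, hGanti, hGφ⟩ := exists_straightening hαβ hFo.continuousOn hneg hφ
  have hinj := hGanti.injOn
  have hadd : ∀ s t, 0 ≤ s → 0 ≤ t → ∀ x ∈ Ioo α β, φ (s + t) x = φ s (φ t x) := by
    intro s t hs ht x hx
    apply hinj (hφ.mem x hx _ (by positivity)) (hφ.mem _ (hφ.mem x hx t ht) s hs)
    rw [hGφ x hx _ (by positivity), hGφ _ (hφ.mem x hx t ht) s hs, hGφ x hx t ht]
    ring
  have hle : ∀ t, 0 ≤ t → ∀ x ∈ Ioo α β, φ t x ≤ x := fun t ht x hx => by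
    rw [← hGanti.le_iff_ge hx (hφ.mem x hx t ht), hGφ x hx t ht]
    linarith
  have hderiv : ∀ t, 0 ≤ t → ∀ x ∈ Ioo α β, HasDerivAt (φ t) (F (φ t x) / F x) x := by
    intro t ht x hx
    have hy := hφ.mem x hx t ht
    have hne : (F (φ t x))⁻¹ ≠ 0 := inv_ne_zero (hneg _ hy).ne
    have hinvd := ((hG _ hy).to_localInverse hne).hasDerivAt
    have hGy : G (φ t x) = G x + t := hGφ x hx t ht
    have hnear : Tendsto (fun z => G z + t) (𝓝 x) (𝓝 (G (φ t x))) := by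
      rw [hGy]
      exact ((hG x hx).hasDerivAt.continuousAt.add continuousAt_const)
    have hmem : ∀ᶠ w in 𝓝 (G (φ t x)),
        (hG _ hy).localInverse G _ _ hne w ∈ Ioo α β := by
      have := hinvd.continuousAt
      refine this.eventually_mem (isOpen_Ioo.mem_nhds ?_)
      rw [HasStrictDerivAt.localInverse, HasStrictFDerivAt.localInverse_apply_image]
      exact hy
    have hright : ∀ᶠ w in 𝓝 (G (φ t x)), G ((hG _ hy).localInverse G _ _ hne w) = w :=
      HasStrictFDerivAt.eventually_right_inverse _
    -- The translation identity reads `φ t = G⁻¹ ∘ (G + t)`; near `x` a local inverse of `G`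
    -- suffices, and its differentiability gives that of `φ t`.
    have heq : φ t =ᶠ[𝓝 x] fun z => (hG _ hy).localInverse G _ _ hne (G z + t) := by
      filter_upwards [hnear.eventually hmem, hnear.eventually hright,
        isOpen_Ioo.mem_nhds hx] with z h1 h2 hz
      exact hinj (hφ.mem z hz t ht) h1 (by rw [h2, hGφ z hz t ht])
    have hc : HasDerivAt (fun z => G z + t) (F x)⁻¹ x := (hG x hx).hasDerivAt.add_const t
    rw [hGy] at hinvd
    have := (hinvd.comp x hc).congr_of_eventuallyEq heq
    rwa [inv_inv, ← div_eq_mul_inv] at this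
  obtain ⟨L, hL0, hL⟩ : ∃ L, 0 ≤ L ∧ ∀ x ∈ Ioo α β, ‖deriv F x‖ ≤ L := by
    -- The derivative is bounded up to the endpoints because `F` is `C¹` on the closed interval.
    obtain ⟨L, hL⟩ := isCompact_Icc.exists_bound_of_continuousOn
      (hF.continuousOn_derivWithin (uniqueDiffOn_Icc hαβ) le_rfl)
    refine ⟨|L|, abs_nonneg L, fun x hx => le_trans ?_ (le_abs_self L)⟩
    rw [← derivWithin_of_mem_nhds (Icc_mem_nhds hx.1 hx.2)]
    exact hL x (Ioo_subset_Icc_self hx)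
  have hFφ : ∀ x ∈ Ioo α β, ContinuousOn (fun t => F (φ t x)) (Ici 0) := fun x hx =>
    hFo.continuousOn.comp (hφ.continuousOn_time hx) fun t ht => hφ.mem x hx t ht
  refine ⟨L, ⟨hL0, hφ.initial, fun t ht x hx => hφ.mem x hx t ht, hadd, ?_, hderiv,
    fun x hx => hφ.continuousOn_time hx, fun x hx => (hFφ x hx).div_const _, ?_, ?_, ?_, ?_, ?_,
    ?_⟩⟩
  · intro t ht x hx y hy hxy
    apply hinj hx hy
    have := hGφ x hx t ht
    rw [hxy, hGφ y hy t ht] at this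
    linarith
  · intro t ht
    exact (hFo.continuousOn.comp (fun x hx => (hderiv t ht x hx).continuousAt.continuousWithinAt)
      fun x hx => hφ.mem x hx t ht).div hFo.continuousOn fun x hx => (hneg x hx).ne
  · intro s t hs ht x hx
    rw [hadd s t hs ht x hx, div_mul_div_cancel₀ (hneg _ (hφ.mem x hx t ht)).ne]
  · intro t ht x hx
    rw [div_le_one_of_neg (hneg x hx)]
    exact hFanti (Ioo_subset_Icc_self (hφ.mem x hx t ht)) (Ioo_subset_Icc_self hx)
      (hle t ht x hx)
  · intro t ht x hx
    have hpos : 0 < F (φ t x) / F x := div_pos_of_neg_of_neg (hneg _ (hφ.mem x hx t ht)) (hneg x hx)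
    rw [← Real.le_log_iff_exp_le hpos, ← hφ.integral_deriv_comp isOpen_Ioo hFo hneg hx ht]
    have := intervalIntegral.norm_integral_le_of_norm_le_const (a := 0) (b := t) (C := L)
      (f := fun s => deriv F (φ s x)) fun s hs => by
        rw [uIoc_of_le ht] at hs
        exact hL _ (hφ.mem x hx s hs.1.le)
    rw [sub_zero, abs_of_nonneg ht] at this
    exact (abs_le.1 this).1
  · intro x hx
    have hlim : Tendsto (fun t => φ t x) atTop (𝓝[Icc α β] α) := by
      refine tendsto_nhdsWithin_iff.2 ⟨tendsto_order.2 ⟨fun a ha => ?_, fun a ha => ?_⟩, ?_⟩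
      · filter_upwards [eventually_ge_atTop 0] with t ht using ha.trans (hφ.mem x hx t ht).1
      · obtain ⟨b, hb1, hb2⟩ := exists_between (lt_min ha hαβ)
        have hb : b ∈ Ioo α β := ⟨hb1, hb2.trans_le (min_le_right _ _)⟩
        -- The orbit of `x` is at or below `b` from time `G b - G x` on.
        filter_upwards [eventually_ge_atTop 0, eventually_ge_atTop (G b - G x)] with t ht ht'
        refine lt_of_le_of_lt ?_ (hb2.trans_le (min_le_left _ _))
        rw [← hGanti.le_iff_ge hb (hφ.mem x hx t ht), hGφ x hx t ht]
        linarith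
      · filter_upwards [eventually_ge_atTop 0] with t ht
          using Ioo_subset_Icc_self (hφ.mem x hx t ht)
    have h1 := ((hF.continuousOn α (left_mem_Icc.2 hαβ.le)).tendsto.comp hlim).div_const (F x)
    rwa [hFα, zero_div] at h1
  · intro y hy
    obtain ⟨t, ht, hty⟩ := hleave y hy (hneg y hy).ne
    -- Ranges shrink with time, as `φ s = φ t ∘ φ (s - t)`, so a point that has left never returns.
    filter_upwards [eventually_ge_atTop t] with s hs
    rintro ⟨x, hx, rfl⟩
    refine hty ⟨φ (s - t) x, hφ.mem x hx _ (sub_nonneg.2 hs), ?_⟩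
    rw [← hadd t (s - t) ht.le (sub_nonneg.2 hs) x hx, add_sub_cancel]

theorem cocycle_eq_rpow {Ω : Set ℝ} (hΩ : IsOpen Ω) {F : ℝ → ℝ}
    (hF : ContDiffOn ℝ 1 F Ω) (hneg : ∀ x ∈ Ω, F x < 0)
    {φ : ℝ → ℝ → ℝ} (hφ : IsSemiflowOf F Ω φ) (lam : ℝ) {x : ℝ} (hx : x ∈ Ω) {t : ℝ}
    (ht : 0 ≤ t) :
    cocycle (fun x => -lam * deriv F x) φ t x = (F (φ t x) / F x) ^ (-lam) := by
  rw [cocycle, intervalIntegral.integral_const_mul,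
    hφ.integral_deriv_comp hΩ hF hneg hx ht,
    Real.rpow_def_of_pos (div_pos_of_neg_of_neg (hneg _ (hφ.mem x hx t ht)) (hneg x hx)), mul_comm]

/-! ### Abstract facts on operator semigroups -/

/-- A locally bounded family of operators is strongly continuous if it is so on a dense set. -/
theorem continuous_orbit_of_dense {X : Type*} [NormedAddCommGroup X] [NormedSpace ℝ X]
    {T : ℝ≥0 → (X →L[ℝ] X)} (hb : ∀ N : ℝ≥0, ∃ C : ℝ, ∀ t ≤ N, ∀ x, ‖T t x‖ ≤ C * ‖x‖)
    {S : Set X} (hS : Dense S) (hc : ∀ x ∈ S, Continuous fun t => T t x) (x : X) :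
    Continuous fun t => T t x := by
  refine continuous_of_locally_uniform_approx_of_continuousAt fun t₀ u hu => ?_
  obtain ⟨ε, hε, hεu⟩ := Metric.mem_uniformity_dist.1 hu
  obtain ⟨C, hC⟩ := hb (t₀ + 1)
  have hC0 : 0 < max C 1 := lt_max_of_lt_right one_pos
  obtain ⟨y, hy, hxy⟩ := hS.exists_dist_lt x (div_pos hε hC0)
  refine ⟨Iio (t₀ + 1), Iio_mem_nhds (lt_add_one t₀), fun t => T t y, (hc y hy).continuousAt,
    fun t ht => hεu ?_⟩
  rw [dist_eq_norm, ← map_sub]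
  calc ‖T t (x - y)‖ ≤ C * ‖x - y‖ := hC t (le_of_lt ht) _
    _ ≤ max C 1 * ‖x - y‖ := by gcongr; exact le_max_left _ _
    _ < max C 1 * (ε / max C 1) := by rw [← dist_eq_norm]; gcongr
    _ = ε := mul_div_cancel₀ _ hC0.ne'

/-- Birkhoff transitivity argument: if every `z` is hit by the operators from points converging
to an arbitrary `y`, then some orbit is dense. -/
theorem isHypercyclicSemigroup_of_forall_exists_tendsto {X : Type*} [NormedAddCommGroup X]
    [NormedSpace ℝ X] [CompleteSpace X] [SecondCountableTopology X] {T : ℝ≥0 → (X →L[ℝ] X)}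
    (h : ∀ y z : X, ∃ v : ℝ≥0 → X, Tendsto v atTop (𝓝 y) ∧ ∀ s, T s (v s) = z) :
    IsHypercyclicSemigroup T := by
  have hB := TopologicalSpace.isBasis_countableBasis X
  have : Countable (TopologicalSpace.countableBasis X) :=
    (TopologicalSpace.countable_countableBasis X).to_subtype
  -- Baire: for each basic open `V`, the vectors whose orbit meets `V` form a dense open set.
  have hd : Dense (⋂ V : TopologicalSpace.countableBasis X, ⋃ t, T t ⁻¹' (V : Set X)) := by
    refine dense_iInter_of_isOpen
      (fun V => isOpen_iUnion fun t => (hB.isOpen V.2).preimage (T t).continuous) fun V => ?_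
    refine dense_iff_inter_open.2 fun W hW ⟨y, hy⟩ => ?_
    obtain ⟨z, hz⟩ := TopologicalSpace.nonempty_of_mem_countableBasis V.2
    obtain ⟨v, hv, hT⟩ := h y z
    obtain ⟨s, hs⟩ := (hv.eventually (hW.mem_nhds hy)).exists
    exact ⟨v s, hs, mem_iUnion.2 ⟨s, by rw [mem_preimage, hT]; exact hz⟩⟩
  obtain ⟨x, hx⟩ := hd.nonempty
  refine ⟨x, hB.dense_iff.2 fun V hV _ => ?_⟩
  obtain ⟨t, ht⟩ := mem_iUnion.1 (mem_iInter.1 hx ⟨V, hV⟩)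
  exact ⟨T t x, ht, t, rfl⟩

/-- An orbit tending to `0` is bounded: by compactness on an initial time interval, by convergence
afterwards. A bounded set is not dense in a nonzero normed space. -/
theorem IsStableSemigroup.not_isHypercyclicSemigroup {X : Type*} [NormedAddCommGroup X]
    [NormedSpace ℝ X] [Nontrivial X] {T : ℝ≥0 → (X →L[ℝ] X)} (hT : IsC0Semigroup T)
    (h : IsStableSemigroup T) : ¬ IsHypercyclicSemigroup T := by
  rintro ⟨x, hx⟩
  refine NormedSpace.unbounded_univ ℝ X ?_
  rw [← hx.closure_eq]
  refine Bornology.IsBounded.closure ?_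
  obtain ⟨N, hN⟩ := eventually_atTop.1 ((h x).eventually (eventually_le_nhds one_pos))
  obtain ⟨C, hC⟩ := (isCompact_Icc (a := 0) (b := N)).exists_bound_of_continuousOn
    (hT.continuous_orbit x).continuousOn
  refine isBounded_iff_forall_norm_le.2 ⟨max C 1, ?_⟩
  rintro _ ⟨t, rfl⟩
  rcases le_total t N with ht | ht
  · exact (hC t ⟨zero_le, ht⟩).trans (le_max_left _ _)
  · exact (hN t ht).trans (le_max_right _ _)

/-! ### Convergence to zero in `L^p` -/

theorem tendsto_eLpNorm_of_tendsto_lintegral {ι α : Type*} [MeasurableSpace α] {μ : Measure α}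
    {p : ℝ≥0∞} (hp0 : p ≠ 0) (hp : p ≠ ∞) {l : Filter ι} {f : ι → α → ℝ}
    (h : Tendsto (fun i => ∫⁻ x, ‖f i x‖ₑ ^ p.toReal ∂μ) l (𝓝 0)) :
    Tendsto (fun i => eLpNorm (f i) p μ) l (𝓝 0) := by
  have hq : 0 < 1 / p.toReal := one_div_pos.2 (ENNReal.toReal_pos hp0 hp)
  have := (ENNReal.continuous_rpow_const (y := 1 / p.toReal)).continuousAt.tendsto.comp h
  rw [ENNReal.zero_rpow_of_pos hq] at this
  exact this.congr fun i => (eLpNorm_eq_lintegral_rpow_enorm_toReal hp0 hp).symm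

theorem tendsto_eLpNorm_of_bounded {ι α : Type*} [MeasurableSpace α] {μ : Measure α}
    [IsFiniteMeasure μ] {p : ℝ≥0∞} (hp0 : p ≠ 0) (hp : p ≠ ∞) {l : Filter ι}
    [l.IsCountablyGenerated] {f : ι → α → ℝ} (hf : ∀ᶠ i in l, AEStronglyMeasurable (f i) μ)
    {C : ℝ} (hC : ∀ᶠ i in l, ∀ᵐ x ∂μ, ‖f i x‖ ≤ C)
    (h : ∀ᵐ x ∂μ, Tendsto (fun i => f i x) l (𝓝 0)) :
    Tendsto (fun i => eLpNorm (f i) p μ) l (𝓝 0) := by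
  have hq : 0 < p.toReal := ENNReal.toReal_pos hp0 hp
  refine tendsto_eLpNorm_of_tendsto_lintegral hp0 hp ?_
  rw [← lintegral_zero (μ := μ)]
  refine tendsto_lintegral_filter_of_dominated_convergence'
    (fun _ => ENNReal.ofReal C ^ p.toReal)
    (hf.mono fun i hi => hi.enorm.pow_const _) (hC.mono fun i hi => hi.mono fun x hx => ?_)
    ?_ (h.mono fun x hx => ?_)
  · gcongr
    rw [← ofReal_norm]
    exact ENNReal.ofReal_le_ofReal hx
  · rw [lintegral_const]
    exact ENNReal.mul_ne_top (ENNReal.rpow_ne_top_of_nonneg hq.le ENNReal.ofReal_ne_top)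
      (measure_ne_top _ _)
  · have := (ENNReal.continuous_rpow_const (y := p.toReal)).continuousAt.tendsto.comp
      ((continuous_enorm (E := ℝ)).continuousAt.tendsto.comp hx)
    rwa [enorm_zero, ENNReal.zero_rpow_of_pos hq] at this

/-! ### Change of variables and the weighted composition operators -/

namespace IsContractingFlow

variable {Ω : Set ℝ} {φ D : ℝ → ℝ → ℝ} {L : ℝ}

theorem D_pos (h : IsContractingFlow Ω φ D L) {t : ℝ} (ht : 0 ≤ t) {x : ℝ} (hx : x ∈ Ω) :
    0 < D t x := (Real.exp_pos _).trans_le (h.le_D t ht x hx)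

theorem continuousOn (h : IsContractingFlow Ω φ D L) {t : ℝ} (ht : 0 ≤ t) :
    ContinuousOn (φ t) Ω := fun x hx => (h.hasDerivAt t ht x hx).continuousAt.continuousWithinAt

theorem image_subset (h : IsContractingFlow Ω φ D L) {t : ℝ} (ht : 0 ≤ t) : φ t '' Ω ⊆ Ω :=
  image_subset_iff.2 fun x hx => h.mem t ht x hx

theorem rpow_le (h : IsContractingFlow Ω φ D L) {t : ℝ} (ht : 0 ≤ t) {x : ℝ} (hx : x ∈ Ω)
    (r : ℝ) : D t x ^ r ≤ Real.exp (L * t * |r|) := by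
  have hLt : 0 ≤ L * t := mul_nonneg h.nonneg ht
  have hlog : -(L * t) ≤ Real.log (D t x) :=
    (Real.le_log_iff_exp_le (h.D_pos ht hx)).2 (h.le_D t ht x hx)
  have hlog' : Real.log (D t x) ≤ 0 := Real.log_nonpos (h.D_pos ht hx).le (h.D_le_one t ht x hx)
  rw [Real.rpow_def_of_pos (h.D_pos ht hx)]
  refine Real.exp_le_exp.2 ((le_abs_self _).trans ?_)
  rw [abs_mul]
  gcongr
  exact abs_le.2 ⟨hlog, hlog'.trans hLt⟩

theorem lintegral_image (h : IsContractingFlow Ω φ D L) (hΩ : MeasurableSet Ω) {t : ℝ}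
    (ht : 0 ≤ t) (g : ℝ → ℝ≥0∞) :
    ∫⁻ y in φ t '' Ω, g y = ∫⁻ x in Ω, ENNReal.ofReal (D t x) * g (φ t x) := by
  rw [lintegral_image_eq_lintegral_abs_deriv_mul hΩ
    (fun x hx => (h.hasDerivAt t ht x hx).hasDerivWithinAt) (h.injOn t ht) g]
  exact setLIntegral_congr_fun hΩ fun x hx => by rw [abs_of_pos (h.D_pos ht hx)]

theorem measurableEmbedding (h : IsContractingFlow Ω φ D L) (hΩ : MeasurableSet Ω) {t : ℝ}
    (ht : 0 ≤ t) : MeasurableEmbedding (Ω.domRestrict (φ t)) :=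
  (h.continuousOn ht).measurableEmbedding hΩ (h.injOn t ht)

theorem measurableSet_image (h : IsContractingFlow Ω φ D L) (hΩ : MeasurableSet Ω) {t : ℝ}
    (ht : 0 ≤ t) : MeasurableSet (φ t '' Ω) := by
  have := (h.measurableEmbedding hΩ ht).measurableSet_range
  rwa [range_domRestrict] at this

theorem aemeasurable (h : IsContractingFlow Ω φ D L) (hΩ : MeasurableSet Ω) {t : ℝ}
    (ht : 0 ≤ t) : AEMeasurable (φ t) (volume.restrict Ω) :=
  (h.continuousOn ht).aemeasurable hΩ

/-- Positivity of the Jacobian makes preimages of null sets null; this is what lets `f ∘ φ t` be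
defined on almost-everywhere classes. -/
theorem map_absolutelyContinuous (h : IsContractingFlow Ω φ D L) (hΩ : MeasurableSet Ω) {t : ℝ}
    (ht : 0 ≤ t) : (volume.restrict Ω).map (φ t) ≪ volume.restrict Ω := by
  refine Measure.AbsolutelyContinuous.mk fun s hs h0 => ?_
  have h1 : ∫⁻ y in φ t '' Ω, s.indicator 1 y = 0 := by
    rw [lintegral_indicator_one hs]
    exact le_antisymm
      ((Measure.le_iff'.1 (Measure.restrict_mono (h.image_subset ht) le_rfl) s).trans h0.le) zero_le
  rw [h.lintegral_image hΩ ht, lintegral_eq_zero_iff'] at h1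
  · rw [Measure.map_apply_of_aemeasurable (h.aemeasurable hΩ ht) hs]
    refine measure_mono_null_ae (t := ∅) ?_ measure_empty
    filter_upwards [h1, ae_restrict_mem hΩ] with x hx hxΩ
    intro hxs
    have hxs : φ t x ∈ s := hxs
    simp [hxs] at hx
    exact absurd hx (h.D_pos ht hxΩ).not_ge
  · exact (((h.D_continuousOn t ht).aemeasurable hΩ).ennreal_ofReal).mul
      ((measurable_one.indicator hs).comp_aemeasurable (h.aemeasurable hΩ ht))

theorem ae_comp (h : IsContractingFlow Ω φ D L) (hΩ : MeasurableSet Ω) {t : ℝ}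
    (ht : 0 ≤ t) {P : ℝ → Prop} (hP : ∀ᵐ y ∂volume.restrict Ω, P y) :
    ∀ᵐ x ∂volume.restrict Ω, P (φ t x) :=
  ae_of_ae_map (h.aemeasurable hΩ ht) ((h.map_absolutelyContinuous hΩ ht).ae_le hP)

theorem aestronglyMeasurable_weightedComp (h : IsContractingFlow Ω φ D L) (hΩ : MeasurableSet Ω)
    (lam : ℝ) {t : ℝ} (ht : 0 ≤ t) {f : ℝ → ℝ} (hf : AEStronglyMeasurable f (volume.restrict Ω)) :
    AEStronglyMeasurable (fun x => D t x ^ (-lam) * f (φ t x)) (volume.restrict Ω) :=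
  (((h.D_continuousOn t ht).aemeasurable hΩ).pow_const _).aestronglyMeasurable.mul
    ((hf.mono_ac (h.map_absolutelyContinuous hΩ ht)).comp_aemeasurable (h.aemeasurable hΩ ht))

theorem eLpNorm_weightedComp_le (h : IsContractingFlow Ω φ D L) (hΩ : MeasurableSet Ω)
    (lam : ℝ) {p : ℝ≥0∞} (hp0 : p ≠ 0) (hp : p ≠ ∞) {t : ℝ} (ht : 0 ≤ t) {C : ℝ}
    (hC : ∀ x ∈ Ω, D t x ^ (-(1 + lam * p.toReal)) ≤ C) (f : ℝ → ℝ) :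
    eLpNorm (fun x => D t x ^ (-lam) * f (φ t x)) p (volume.restrict Ω) ≤
      ENNReal.ofReal C ^ (1 / p.toReal) * eLpNorm f p (volume.restrict (φ t '' Ω)) := by
  have hq : 0 < p.toReal := ENNReal.toReal_pos hp0 hp
  rw [eLpNorm_eq_lintegral_rpow_enorm_toReal hp0 hp, eLpNorm_eq_lintegral_rpow_enorm_toReal hp0 hp,
    ← ENNReal.mul_rpow_of_nonneg _ _ (one_div_pos.2 hq).le]
  refine ENNReal.rpow_le_rpow ?_ (one_div_pos.2 hq).le
  rw [h.lintegral_image hΩ ht, ← lintegral_const_mul' _ _ ENNReal.ofReal_ne_top]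
  refine setLIntegral_mono' hΩ fun x hx => ?_
  have hD := h.D_pos ht hx
  -- One factor `D` is split off to serve as the Jacobian; the remaining power is what `C` bounds.
  have hpow : (D t x ^ (-lam)) ^ p.toReal = D t x ^ (-(1 + lam * p.toReal)) * D t x := by
    rw [← Real.rpow_mul hD.le, ← Real.rpow_add_one hD.ne']
    ring_nf
  rw [enorm_mul, ENNReal.mul_rpow_of_nonneg _ _ hq.le, Real.enorm_of_nonneg (by positivity),
    ENNReal.ofReal_rpow_of_nonneg (by positivity) hq.le, hpow, ENNReal.ofReal_mul (by positivity),
    ← mul_assoc]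
  gcongr
  exact hC x hx

theorem eLpNorm_weightedComp_le_exp (h : IsContractingFlow Ω φ D L) (hΩ : MeasurableSet Ω)
    (lam : ℝ) {p : ℝ≥0∞} (hp0 : p ≠ 0) (hp : p ≠ ∞) {t N : ℝ} (ht : 0 ≤ t) (htN : t ≤ N)
    (f : ℝ → ℝ) :
    eLpNorm (fun x => D t x ^ (-lam) * f (φ t x)) p (volume.restrict Ω) ≤
      ENNReal.ofReal (Real.exp (L * N * |-(1 + lam * p.toReal)|)) ^ (1 / p.toReal) *
        eLpNorm f p (volume.restrict Ω) := by
  refine (h.eLpNorm_weightedComp_le hΩ lam hp0 hp ht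
    (C := Real.exp (L * N * |-(1 + lam * p.toReal)|)) (fun x hx => ?_) f).trans ?_
  · refine (h.rpow_le ht hx _).trans (Real.exp_le_exp.2 ?_)
    have := h.nonneg
    gcongr
  · gcongr
    exact h.image_subset ht

theorem memLp_weightedComp (h : IsContractingFlow Ω φ D L) (hΩ : MeasurableSet Ω)
    (lam : ℝ) {p : ℝ≥0∞} (hp0 : p ≠ 0) (hp : p ≠ ∞) {t : ℝ} (ht : 0 ≤ t) {f : ℝ → ℝ}
    (hf : MemLp f p (volume.restrict Ω)) :
    MemLp (fun x => D t x ^ (-lam) * f (φ t x)) p (volume.restrict Ω) :=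
  ⟨h.aestronglyMeasurable_weightedComp hΩ lam ht hf.1,
    (h.eLpNorm_weightedComp_le_exp hΩ lam hp0 hp ht le_rfl f).trans_lt
      (ENNReal.mul_lt_top (ENNReal.rpow_lt_top_of_nonneg (by positivity) ENNReal.ofReal_ne_top)
        hf.2)⟩

theorem exists_weightedComposition (h : IsContractingFlow Ω φ D L) (hΩ : MeasurableSet Ω)
    (lam : ℝ) {p : ℝ≥0∞} [Fact (1 ≤ p)] (hp : p ≠ ∞) :
    ∃ T : ℝ≥0 → (Lp ℝ p (volume.restrict Ω) →L[ℝ] Lp ℝ p (volume.restrict Ω)),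
      ∀ t f, T t f =ᵐ[volume.restrict Ω] fun x => D t x ^ (-lam) * f (φ t x) := by
  have hp0 : p ≠ 0 := (one_pos.trans_le Fact.out).ne'
  have hmem := fun (t : ℝ≥0) (f : Lp ℝ p (volume.restrict Ω)) =>
    h.memLp_weightedComp hΩ lam hp0 hp t.coe_nonneg (Lp.memLp f)
  have hlin : ∀ t : ℝ≥0, ∃ A : Lp ℝ p (volume.restrict Ω) →ₗ[ℝ] Lp ℝ p (volume.restrict Ω),
      ∀ f, A f = (hmem t f).toLp _ := fun t => by
    refine ⟨⟨⟨fun f => (hmem t f).toLp _, fun f g => ?_⟩, fun c f => ?_⟩, fun f => rfl⟩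
    · rw [← MemLp.toLp_add]
      refine MemLp.toLp_congr _ _ ?_
      filter_upwards [h.ae_comp hΩ t.coe_nonneg (Lp.coeFn_add f g)] with x hx
      simp only [Pi.add_apply] at hx ⊢
      rw [hx, mul_add]
    · rw [RingHom.id_apply, ← MemLp.toLp_const_smul]
      refine MemLp.toLp_congr (hmem t (c • f)) _ ?_
      filter_upwards [h.ae_comp hΩ t.coe_nonneg (Lp.coeFn_smul c f)] with x hx
      simp only [Pi.smul_apply, smul_eq_mul] at hx ⊢
      rw [hx, mul_left_comm]
  choose A hA using hlin
  refine ⟨fun t => (A t).mkContinuousOfExistsBound ⟨(ENNReal.ofReal (Real.exp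
    (L * t * |-(1 + lam * p.toReal)|)) ^ (1 / p.toReal)).toReal, fun f => ?_⟩, fun t f => ?_⟩
  · rw [hA, Lp.norm_toLp, Lp.norm_def, ← ENNReal.toReal_mul]
    refine ENNReal.toReal_mono (ENNReal.mul_ne_top (ENNReal.rpow_ne_top_of_nonneg (by positivity)
      ENNReal.ofReal_ne_top) (Lp.eLpNorm_ne_top f))
      (h.eLpNorm_weightedComp_le_exp hΩ lam hp0 hp t.coe_nonneg le_rfl f)
  · rw [LinearMap.mkContinuousOfExistsBound_apply, hA]
    exact MemLp.coeFn_toLp _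

/-! ### Semigroup law and strong continuity -/

variable {lam : ℝ} {p : ℝ≥0∞} [Fact (1 ≤ p)]
  {T : ℝ≥0 → (Lp ℝ p (volume.restrict Ω) →L[ℝ] Lp ℝ p (volume.restrict Ω))}

/-- The operators are bounded uniformly on compact time intervals, so bounded continuous `g`
suffice. For these the integrand is continuous in time and locally uniformly bounded, and dominated
convergence applies as `Ω` has finite measure. -/
theorem continuous_orbit (h : IsContractingFlow Ω φ D L) (hΩ : MeasurableSet Ω)
    (hfin : volume Ω ≠ ∞) (hp : p ≠ ∞)
    (hT : ∀ t f, T t f =ᵐ[volume.restrict Ω] fun x => D t x ^ (-lam) * f (φ t x))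
    (f : Lp ℝ p (volume.restrict Ω)) : Continuous fun t => T t f := by
  have hp0 : p ≠ 0 := (one_pos.trans_le Fact.out).ne'
  have : IsFiniteMeasure (volume.restrict Ω) := isFiniteMeasure_restrict.2 hfin
  refine continuous_orbit_of_dense (fun N => ⟨(ENNReal.ofReal (Real.exp
    (L * N * |-(1 + lam * p.toReal)|)) ^ (1 / p.toReal)).toReal, fun t ht f => ?_⟩)
    (BoundedContinuousFunction.toLp_denseRange ℝ (volume.restrict Ω) ℝ hp) ?_ f
  · rw [Lp.norm_def, Lp.norm_def, ← ENNReal.toReal_mul, eLpNorm_congr_ae (hT t f)]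
    exact ENNReal.toReal_mono (ENNReal.mul_ne_top (ENNReal.rpow_ne_top_of_nonneg (by positivity)
      ENNReal.ofReal_ne_top) (Lp.eLpNorm_ne_top f))
      (h.eLpNorm_weightedComp_le_exp hΩ lam hp0 hp t.coe_nonneg (NNReal.coe_le_coe.2 ht) f)
  rintro _ ⟨g, rfl⟩
  have hTg : ∀ t, T t (BoundedContinuousFunction.toLp p (volume.restrict Ω) ℝ g)
      =ᵐ[volume.restrict Ω] fun x => D t x ^ (-lam) * g (φ t x) := fun t => by
    filter_upwards [hT t _, h.ae_comp hΩ t.coe_nonneg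
      (BoundedContinuousFunction.coeFn_toLp (E := ℝ) p (volume.restrict Ω) ℝ g)] with x h1 h2
    rw [h1, h2]
  refine continuous_iff_continuousAt.2 fun t₀ => ?_
  rw [ContinuousAt, Lp.tendsto_Lp_iff_tendsto_eLpNorm']
  have hcongr : ∀ t, eLpNorm (T t (BoundedContinuousFunction.toLp p (volume.restrict Ω) ℝ g) -
      T t₀ (BoundedContinuousFunction.toLp p (volume.restrict Ω) ℝ g) : ℝ → ℝ) p
        (volume.restrict Ω) =
      eLpNorm (fun x => D t x ^ (-lam) * g (φ t x) - D t₀ x ^ (-lam) * g (φ t₀ x)) p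
        (volume.restrict Ω) := fun t => eLpNorm_congr_ae ((hTg t).sub (hTg t₀))
  simp_rw [hcongr]
  have hbound : ∀ t ≤ t₀ + 1, ∀ x ∈ Ω, ‖D t x ^ (-lam) * g (φ t x)‖ ≤
      Real.exp (L * (t₀ + 1) * |-lam|) * ‖g‖ := fun t ht x hx => by
    rw [norm_mul, Real.norm_of_nonneg (Real.rpow_nonneg (h.D_pos t.coe_nonneg hx).le _)]
    refine mul_le_mul ((h.rpow_le t.coe_nonneg hx _).trans (Real.exp_le_exp.2 ?_)) (g.norm_coe_le_norm _)
      (norm_nonneg _) (Real.exp_pos _).le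
    have := h.nonneg
    have ht' : (t : ℝ) ≤ t₀ + 1 := by exact_mod_cast ht
    gcongr
  refine tendsto_eLpNorm_of_bounded hp0 hp
    (C := Real.exp (L * (t₀ + 1) * |-lam|) * ‖g‖ + Real.exp (L * (t₀ + 1) * |-lam|) * ‖g‖)
    (Eventually.of_forall fun t =>
      (h.aestronglyMeasurable_weightedComp hΩ lam t.coe_nonneg g.continuous.aestronglyMeasurable).sub
      (h.aestronglyMeasurable_weightedComp hΩ lam t₀.coe_nonneg g.continuous.aestronglyMeasurable)) ?_ ?_
  · filter_upwards [Iio_mem_nhds (lt_add_one t₀)] with t ht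
    filter_upwards [ae_restrict_mem hΩ] with x hx
    exact (norm_sub_le _ _).trans (add_le_add (hbound t (le_of_lt ht) x hx)
      (hbound t₀ (lt_add_one t₀).le x hx))
  · filter_upwards [ae_restrict_mem hΩ] with x hx
    have hcoe : Tendsto (fun t : ℝ≥0 => (t : ℝ)) (𝓝 t₀) (𝓝[Ici 0] (t₀ : ℝ)) :=
      tendsto_nhdsWithin_iff.2 ⟨NNReal.continuous_coe.continuousAt, Eventually.of_forall fun t => t.coe_nonneg⟩
    have h1 : Tendsto (fun t : ℝ≥0 => D t x) (𝓝 t₀) (𝓝 (D t₀ x)) :=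
      (h.D_continuousOn_time x hx t₀ t₀.coe_nonneg).tendsto.comp hcoe
    have h2 : Tendsto (fun t : ℝ≥0 => φ t x) (𝓝 t₀) (𝓝 (φ t₀ x)) :=
      (h.continuousOn_time x hx t₀ t₀.coe_nonneg).tendsto.comp hcoe
    have h3 := ((h1.rpow_const (p := -lam) (Or.inl (h.D_pos t₀.coe_nonneg hx).ne')).mul
      ((g.continuous.tendsto _).comp h2)).sub_const (D t₀ x ^ (-lam) * g (φ t₀ x))
    rwa [sub_self] at h3

theorem isC0Semigroup (h : IsContractingFlow Ω φ D L) (hΩ : MeasurableSet Ω)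
    (hfin : volume Ω ≠ ∞) (hp : p ≠ ∞)
    (hT : ∀ t f, T t f =ᵐ[volume.restrict Ω] fun x => D t x ^ (-lam) * f (φ t x)) :
    IsC0Semigroup T where
  map_zero := by
    ext1 f
    refine Lp.ext ?_
    filter_upwards [hT 0 f, ae_restrict_mem hΩ] with x hx hxΩ
    -- The chain rule at time `0` gives `D 0 x = D 0 x * D 0 x`, with a positive factor to cancel.
    have hD : D 0 x = 1 := by
      have h1 := h.D_add 0 0 le_rfl le_rfl x hxΩ
      rw [add_zero, h.initial x hxΩ] at h1
      exact (mul_eq_left₀ (h.D_pos le_rfl hxΩ).ne').1 h1.symm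
    rw [hx, NNReal.coe_zero, hD, h.initial x hxΩ, Real.one_rpow, one_mul]
    rfl
  map_add s t := by
    ext1 f
    refine Lp.ext ?_
    filter_upwards [hT (s + t) f, hT s (T t f), h.ae_comp hΩ s.coe_nonneg (hT t f), ae_restrict_mem hΩ]
      with x h1 h2 h3 hx
    -- Composition reverses the order: `T s (T t f)` evaluates `f` at `φ t (φ s x)`, so the flow law
    -- is used for `t + s`.
    rw [h1, ContinuousLinearMap.comp_apply, h2, h3, NNReal.coe_add, add_comm (s : ℝ),
      h.add t s t.coe_nonneg s.coe_nonneg x hx, h.D_add t s t.coe_nonneg s.coe_nonneg x hx,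
      Real.mul_rpow (h.D_pos t.coe_nonneg (h.mem s s.coe_nonneg x hx)).le (h.D_pos s.coe_nonneg hx).le]
    ring
  continuous_orbit := h.continuous_orbit hΩ hfin hp hT

/-! ### Stability when `1 + λ p ≤ 0` -/

/-- The mass of a fixed `L^p` function on the range of the flow vanishes as time grows. -/
theorem tendsto_eLpNorm_image (h : IsContractingFlow Ω φ D L) (hΩ : MeasurableSet Ω)
    (hp : p ≠ ∞) (f : Lp ℝ p (volume.restrict Ω)) :
    Tendsto (fun t : ℝ≥0 => eLpNorm f p (volume.restrict (φ t '' Ω))) atTop (𝓝 0) := by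
  have hp0 : p ≠ 0 := (one_pos.trans_le Fact.out).ne'
  refine (tendsto_eLpNorm_of_tendsto_lintegral (μ := volume.restrict Ω)
    (f := fun t : ℝ≥0 => (φ t '' Ω).indicator f) hp0 hp ?_).congr fun t => ?_
  · rw [← lintegral_zero (μ := volume.restrict Ω)]
    refine tendsto_lintegral_filter_of_dominated_convergence' (fun x => ‖f x‖ₑ ^ p.toReal)
      (Eventually.of_forall fun t => ?_) (Eventually.of_forall fun t => ae_of_all _ fun x => ?_)
      ?_ ?_
    · exact ((Lp.aestronglyMeasurable f).indicator
        (h.measurableSet_image hΩ t.coe_nonneg)).enorm.pow_const _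
    · gcongr
      exact enorm_indicator_le_enorm_self _ _
    · exact ((eLpNorm_lt_top_iff_lintegral_rpow_enorm_lt_top hp0 hp).1 (Lp.eLpNorm_lt_top f)).ne
    · filter_upwards [ae_restrict_mem hΩ] with x hx
      refine tendsto_nhds_of_eventually_eq ?_
      filter_upwards [(NNReal.tendsto_coe_atTop.2 tendsto_id).eventually
        (h.eventually_notMem x hx)] with t ht
      rw [id] at ht
      simp [indicator_of_notMem ht, ENNReal.toReal_pos hp0 hp]
  · rw [eLpNorm_indicator_eq_eLpNorm_restrict (h.measurableSet_image hΩ t.coe_nonneg),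
      Measure.restrict_restrict (h.measurableSet_image hΩ t.coe_nonneg),
      inter_eq_left.2 (h.image_subset t.coe_nonneg)]

theorem isStableSemigroup (h : IsContractingFlow Ω φ D L) (hΩ : MeasurableSet Ω) (hp : p ≠ ∞)
    (hT : ∀ t f, T t f =ᵐ[volume.restrict Ω] fun x => D t x ^ (-lam) * f (φ t x))
    (hlam : 1 + lam * p.toReal ≤ 0) : IsStableSemigroup T := by
  have hp0 : p ≠ 0 := (one_pos.trans_le Fact.out).ne'
  intro f
  have hle : ∀ t : ℝ≥0, eLpNorm (T t f) p (volume.restrict Ω) ≤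
      eLpNorm f p (volume.restrict (φ t '' Ω)) := fun t => by
    rw [eLpNorm_congr_ae (hT t f)]
    refine (h.eLpNorm_weightedComp_le hΩ lam hp0 hp t.coe_nonneg (C := 1) (fun x hx => ?_) f).trans_eq ?_
    · exact Real.rpow_le_one (h.D_pos t.coe_nonneg hx).le (h.D_le_one t t.coe_nonneg x hx) (neg_nonneg.2 hlam)
    · simp
  have h0 := tendsto_of_tendsto_of_tendsto_of_le_of_le tendsto_const_nhds
    (h.tendsto_eLpNorm_image hΩ hp f) (fun _ => zero_le) hle
  exact (ENNReal.tendsto_toReal ENNReal.zero_ne_top).comp h0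

/-! ### Hypercyclicity when `1 + λ p > 0` -/

theorem tendsto_lintegral_rpow (h : IsContractingFlow Ω φ D L) (hΩ : MeasurableSet Ω)
    (hp : p ≠ ∞) {r : ℝ} (hr : 0 < r) {z : ℝ → ℝ} (hz : MemLp z p (volume.restrict Ω)) :
    Tendsto (fun t : ℝ≥0 => ∫⁻ x in Ω, ENNReal.ofReal (D t x ^ r) * ‖z x‖ₑ ^ p.toReal)
      atTop (𝓝 0) := by
  have hp0 : p ≠ 0 := (one_pos.trans_le Fact.out).ne'
  have hfin := (eLpNorm_lt_top_iff_lintegral_rpow_enorm_lt_top hp0 hp).1 hz.2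
  rw [← lintegral_zero (μ := volume.restrict Ω)]
  refine tendsto_lintegral_filter_of_dominated_convergence' (fun x => ‖z x‖ₑ ^ p.toReal)
    (Eventually.of_forall fun t => ?_) (Eventually.of_forall fun t => ?_) hfin.ne ?_
  · exact (((h.D_continuousOn t t.coe_nonneg).aemeasurable hΩ).pow_const _).ennreal_ofReal.mul
      (hz.1.enorm.pow_const _)
  · filter_upwards [ae_restrict_mem hΩ] with x hx
    refine mul_le_of_le_one_left zero_le (ENNReal.ofReal_le_one.2 ?_)
    exact Real.rpow_le_one (h.D_pos t.coe_nonneg hx).le (h.D_le_one t t.coe_nonneg x hx) hr.le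
  · filter_upwards [ae_restrict_mem hΩ] with x hx
    have h1 : Tendsto (fun t : ℝ≥0 => D t x) atTop (𝓝 0) :=
      (h.tendsto_D x hx).comp (NNReal.tendsto_coe_atTop.2 tendsto_id)
    have h2 := h1.rpow_const (p := r) (Or.inr hr.le)
    rw [Real.zero_rpow hr.ne'] at h2
    have h3 := ENNReal.tendsto_ofReal h2
    rw [ENNReal.ofReal_zero] at h3
    have h4 := ENNReal.Tendsto.mul_const (b := ‖z x‖ₑ ^ p.toReal) h3 (Or.inr
      (ENNReal.rpow_ne_top_of_nonneg ENNReal.toReal_nonneg enorm_ne_top))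
    rwa [zero_mul] at h4

/-- Replacing `y` on the range of the flow produces a preimage of `z` under `T s`. -/
theorem exists_preimage (h : IsContractingFlow Ω φ D L) (hΩ : MeasurableSet Ω) (hp : p ≠ ∞)
    (hT : ∀ t f, T t f =ᵐ[volume.restrict Ω] fun x => D t x ^ (-lam) * f (φ t x))
    (y z : Lp ℝ p (volume.restrict Ω)) (s : ℝ≥0) :
    ∃ v : Lp ℝ p (volume.restrict Ω), T s v = z ∧
      eLpNorm (v - y : ℝ → ℝ) p (volume.restrict Ω) ≤
        (∫⁻ x in Ω, ENNReal.ofReal (D s x ^ (1 + lam * p.toReal)) * ‖z x‖ₑ ^ p.toReal)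
            ^ (1 / p.toReal) +
          eLpNorm y p (volume.restrict (φ s '' Ω)) := by
  have hp0 : p ≠ 0 := (one_pos.trans_le Fact.out).ne'
  have hq : 0 < p.toReal := ENNReal.toReal_pos hp0 hp
  have hz := Lp.stronglyMeasurable z
  have hI := h.measurableSet_image hΩ s.coe_nonneg
  have hDm : Measurable (Ω.domRestrict (D s)) :=
    (continuousOn_iff_continuous_domRestrict.1 (h.D_continuousOn s s.coe_nonneg)).measurable
  -- `T s v = z` forces `v (φ s x) = D s x ^ λ * z x`. Since `φ s` embeds `Ω` measurably, this
  -- prescription on the range extends to a measurable `Z`.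
  obtain ⟨Z, hZm, hZ⟩ := (h.measurableEmbedding hΩ s.coe_nonneg).exists_measurable_extend
    (g := fun x : Ω => D s x ^ lam * z x)
    ((hDm.pow_const lam).mul (hz.measurable.comp measurable_subtype_coe)) fun _ => ⟨0⟩
  have hZ : ∀ x ∈ Ω, Z (φ s x) = D s x ^ lam * z x := fun x hx => congrFun hZ ⟨x, hx⟩
  have hZnorm : ∫⁻ w in φ s '' Ω, ‖Z w‖ₑ ^ p.toReal =
      ∫⁻ x in Ω, ENNReal.ofReal (D s x ^ (1 + lam * p.toReal)) * ‖z x‖ₑ ^ p.toReal := by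
    rw [h.lintegral_image hΩ s.coe_nonneg]
    refine setLIntegral_congr_fun hΩ fun x hx => ?_
    have hD := h.D_pos s.coe_nonneg hx
    rw [hZ x hx, enorm_mul, ENNReal.mul_rpow_of_nonneg _ _ hq.le,
      Real.enorm_of_nonneg (by positivity), ENNReal.ofReal_rpow_of_nonneg (by positivity) hq.le,
      ← mul_assoc, ← ENNReal.ofReal_mul hD.le, ← Real.rpow_mul hD.le, Real.rpow_add hD,
      Real.rpow_one]
  have hdiff : eLpNorm ((φ s '' Ω).indicator (Z - y : ℝ → ℝ)) p (volume.restrict Ω) ≤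
      (∫⁻ x in Ω, ENNReal.ofReal (D s x ^ (1 + lam * p.toReal)) * ‖z x‖ₑ ^ p.toReal)
        ^ (1 / p.toReal) + eLpNorm y p (volume.restrict (φ s '' Ω)) := by
    rw [eLpNorm_indicator_eq_eLpNorm_restrict hI, Measure.restrict_restrict hI,
      inter_eq_left.2 (h.image_subset s.coe_nonneg), ← hZnorm,
      ← eLpNorm_eq_lintegral_rpow_enorm_toReal hp0 hp]
    exact eLpNorm_sub_le hZm.aestronglyMeasurable (Lp.stronglyMeasurable y).aestronglyMeasurable
      Fact.out
  have hzfin : ∫⁻ x in Ω, ENNReal.ofReal (D s x ^ (1 + lam * p.toReal)) * ‖z x‖ₑ ^ p.toReal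
      < ∞ := by
    refine lt_of_le_of_lt (setLIntegral_mono' hΩ fun x hx => mul_le_mul_left
      (ENNReal.ofReal_le_ofReal (h.rpow_le s.coe_nonneg hx _)) _) ?_
    rw [lintegral_const_mul' _ _ ENNReal.ofReal_ne_top]
    exact ENNReal.mul_lt_top ENNReal.ofReal_lt_top
      ((eLpNorm_lt_top_iff_lintegral_rpow_enorm_lt_top hp0 hp).1 (Lp.eLpNorm_lt_top z))
  have hmem : MemLp ((φ s '' Ω).indicator (Z - y : ℝ → ℝ)) p (volume.restrict Ω) :=
    ⟨((hZm.sub (Lp.stronglyMeasurable y).measurable).indicator hI).aestronglyMeasurable,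
      hdiff.trans_lt (ENNReal.add_lt_top.2
        ⟨ENNReal.rpow_lt_top_of_nonneg (by positivity) hzfin.ne,
          (eLpNorm_mono_measure _ (Measure.restrict_mono (h.image_subset s.coe_nonneg) le_rfl)).trans_lt
            (Lp.eLpNorm_lt_top y)⟩)⟩
  have hv := Lp.coeFn_add (hmem.toLp _) y
  -- This `v` equals `Z` on the range and `y` elsewhere.
  refine ⟨hmem.toLp _ + y, Lp.ext ?_, ?_⟩
  · filter_upwards [hT s (hmem.toLp _ + y), h.ae_comp hΩ s.coe_nonneg hv,
      h.ae_comp hΩ s.coe_nonneg hmem.coeFn_toLp, ae_restrict_mem hΩ] with x h1 h2 h3 hx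
    have hD := h.D_pos s.coe_nonneg hx
    rw [h1, h2, Pi.add_apply, h3, indicator_of_mem (mem_image_of_mem _ hx), Pi.sub_apply,
      sub_add_cancel, hZ x hx, ← mul_assoc, ← Real.rpow_add hD, neg_add_cancel, Real.rpow_zero,
      one_mul]
  · refine (eLpNorm_congr_ae ?_).trans_le hdiff
    filter_upwards [hv, hmem.coeFn_toLp] with x h1 h2
    rw [Pi.sub_apply, h1, Pi.add_apply, add_sub_cancel_right, h2]

theorem isHypercyclicSemigroup (h : IsContractingFlow Ω φ D L) (hΩ : MeasurableSet Ω)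
    (hp : p ≠ ∞)
    (hT : ∀ t f, T t f =ᵐ[volume.restrict Ω] fun x => D t x ^ (-lam) * f (φ t x))
    (hlam : 0 < 1 + lam * p.toReal) : IsHypercyclicSemigroup T := by
  have hp0 : p ≠ 0 := (one_pos.trans_le Fact.out).ne'
  have : Fact (p ≠ ∞) := ⟨hp⟩
  refine isHypercyclicSemigroup_of_forall_exists_tendsto fun y z => ?_
  choose v hv hvy using h.exists_preimage hΩ hp hT y z
  refine ⟨v, ?_, hv⟩
  rw [Lp.tendsto_Lp_iff_tendsto_eLpNorm']
  refine tendsto_of_tendsto_of_tendsto_of_le_of_le tendsto_const_nhds ?_ (fun _ => zero_le) hvy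
  have h1 := (ENNReal.continuous_rpow_const (y := 1 / p.toReal)).continuousAt.tendsto.comp
    (h.tendsto_lintegral_rpow hΩ hp hlam (Lp.memLp z))
  rw [ENNReal.zero_rpow_of_pos (one_div_pos.2 (ENNReal.toReal_pos hp0 hp))] at h1
  simpa using h1.add (h.tendsto_eLpNorm_image hΩ hp y)

end IsContractingFlow

/-! ### The equivalence -/

theorem nontrivial_Lp_of_measure_ne_zero {α : Type*} [MeasurableSpace α] {μ : Measure α}
    [IsFiniteMeasure μ] {p : ℝ≥0∞} (hμ : μ ≠ 0) : Nontrivial (Lp ℝ p μ) := by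
  refine ⟨Lp.const p μ (1 : ℝ), 0, fun h => hμ ?_⟩
  have h1 : (fun _ : α => (1 : ℝ)) =ᵐ[μ] fun _ => 0 :=
    (Lp.coeFn_const p μ (1 : ℝ)).symm.trans (by
      rw [h]; exact Lp.coeFn_zero ℝ p μ)
  rw [← ae_eq_bot]
  exact empty_mem_iff_bot.1 (by filter_upwards [h1] with x hx using one_ne_zero hx)

theorem theorem7 (α β : ℝ) (hαβ : α < β) (F : ℝ → ℝ)
    (hF : ContDiffOn ℝ 1 F (Icc α β)) (hFanti : AntitoneOn F (Icc α β))
    (hFneg : ∀ x ∈ Ioc α β, F x < 0) (hFα : F α = 0)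
    (φ : ℝ → ℝ → ℝ) (hφ : IsSemiflowOf F (Ioo α β) φ)
    (hleave : ∀ x ∈ Ioo α β, F x ≠ 0 → ∃ t : ℝ, 0 < t ∧ x ∉ φ t '' Ioo α β)
    (lam : ℝ) (p : ℝ≥0∞) [Fact (1 ≤ p)] (hp : p ≠ ∞) :
    ∃ T : ℝ≥0 → (Lp ℝ p (volume.restrict (Ioo α β)) →L[ℝ] Lp ℝ p (volume.restrict (Ioo α β))),
      IsWeightedComposition (Ioo α β) φ (fun x => -lam * deriv F x) p T ∧
      IsC0Semigroup T ∧
      List.TFAE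
        [IsStableSemigroup T,
         ¬ IsHypercyclicSemigroup T,
         lam ≤ -(1 / p.toReal)] := by
  have hp0 : p ≠ 0 := (one_pos.trans_le Fact.out).ne'
  have hq : 0 < p.toReal := ENNReal.toReal_pos hp0 hp
  obtain ⟨L, h⟩ := isContractingFlow_of_isSemiflowOf hαβ hF hFanti hFneg hFα hφ hleave
  have hfin : volume (Ioo α β) ≠ ∞ := by simp
  obtain ⟨T, hT⟩ := h.exists_weightedComposition measurableSet_Ioo lam (p := p) hp
  have hC0 := h.isC0Semigroup measurableSet_Ioo hfin hp hT
  have : IsFiniteMeasure (volume.restrict (Ioo α β)) := isFiniteMeasure_restrict.2 hfin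
  have : Nontrivial (Lp ℝ p (volume.restrict (Ioo α β))) :=
    nontrivial_Lp_of_measure_ne_zero (by simp [Measure.restrict_eq_zero, hαβ])
  have hlam : lam ≤ -(1 / p.toReal) ↔ 1 + lam * p.toReal ≤ 0 := by
    rw [← neg_div, le_div_iff₀ hq]
    constructor <;> intro <;> linarith
  refine ⟨T, fun t f => ?_, hC0, ?_⟩
  · filter_upwards [hT t f, ae_restrict_mem measurableSet_Ioo] with x hx hxΩ
    rw [hx, cocycle_eq_rpow isOpen_Ioo (hF.mono Ioo_subset_Icc_self)
      (fun y hy => hFneg y (Ioo_subset_Ioc_self hy)) hφ lam hxΩ t.coe_nonneg]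
  · tfae_have 3 → 1 := fun hl => h.isStableSemigroup measurableSet_Ioo hp hT (hlam.1 hl)
    tfae_have 1 → 2 := IsStableSemigroup.not_isHypercyclicSemigroup hC0
    tfae_have 2 → 3 := fun hn => by
      by_contra hl
      exact hn (h.isHypercyclicSemigroup measurableSet_Ioo hp hT
        (not_le.1 fun h' => hl (hlam.2 h')))
    tfae_finish
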